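/- Let $p_1,p_2$ be distinct primes with $p_1,p_2>48$, put $N:=p_1^2p_2^2$, and let $\mathcal R=(\mathcal W,\mathcal R_1,\mathcal R_2)$ be a domino set, that is, a non-empty finite set $\mathcal W$ together with two subsets $\mathcal R_1,\mathcal R_2\subseteq \mathcal W^2$. For $\Omega\subseteq\mathbb Z^2$, an $\mathcal R$-domino function on $\Omega$ is a function $\mathcal T\colon\Omega\to\mathcal W$ such that, for $i=1,2$, $(\mathcal T(s),\mathcal T(s+e_i))\in\mathcal R_i$ whenever $s,s+e_i\in\Omega$, where $e_1=(1,0)$ and $e_2=(0,1)$. The $\mathcal R$-domino problem is solvable on $\Omega$ if such a function exists. For a prime $p$ and an integer $n\neq 0$ let $\nu_p(n)$ be the number of times $p$ divides $n$, and let $f_p(n)\in(\mathbb Z/p\mathbb Z)^\times$ be the class of $n/p^{\nu_p(n)}$ modulo $p$; put $\nu_p(0)=+\infty$ and $f_p(0)=1$. For integers $a,b$, the affine form $n\mapsto an+b$ is non-degenerate modulo $p$ if $a$ and $b$ are not both divisible by $p$. Let $\mathcal S^{\mathcal R}$ be the set of all functions $g=(g_1,g_2,w)\colon\{0,\dots,N-1\}\to(\mathbb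 Z/p_1\mathbb Z)^\times\times(\mathbb Z/p_2\mathbb Z)^\times\times\mathcal W$ for which there exist integers $a,b$ such that $n\mapsto an+b$ is non-degenerate modulo $p_1$ and modulo $p_2$, and an $\mathcal R$-domino function $\mathcal T$ on the rectangle $\{(s_1,s_2)\in\mathbb Z^2: 0\le s_1\le t_1,\ 0\le s_2\le t_2\}$, where $t_l:=1$ if $\nu_{p_l}(a)=0$ and $t_l:=0$ otherwise, such that for every $n\in\{0,\dots,N-1\}$: - $g_l(n)=f_{p_l}(an+b)$ whenever $l\in\{1,2\}$ and $\nu_{p_l}(an+b)\le t_l$; - $w(n)=\mathcal T(\nu_{p_1}(an+b),\nu_{p_2}(an+b))$ whenever $\nu_{p_1}(an+b)\le t_1$ and $\nu_{p_2}(an+b)\le t_2$. An $\mathcal S^{\mathcal R}$-Sudoku solution is a triple $F=(F_1,F_2,w)$ of functions $F_l\colon\{0,\dots,N-1\}\times\mathbb Z\to(\mathbb Z/p_l\mathbb Z)^\times$ ($l=1,2$) and $w\colon\{0,\dots,N-1\}\times\mathbb Z\to\mathcal W$ such that for all integers $j,i$ the function $n\mapsto F(n,jn+i)$ on $\{0,\dots,N-1\}$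 lies in $\mathcal S^{\mathcal R}$. The function $F_l$ has non-constant columns if for every $n\in\{0,\dots,N-1\}$ the function $m\mapsto F_l(n,m)$ is non-constant on $\mathbb Z$. Then the $\mathcal R$-domino problem is solvable on $\mathbb N^2=\{0,1,2,\dots\}^2$ if and only if there exists an $\mathcal S^{\mathcal R}$-Sudoku solution $F=(F_1,F_2,w)$ in which $F_1$ and $F_2$ both have non-constant columns. -/

import Mathlib

universe u v

/-- A domino set `(𝒲, 𝓡₁, 𝓡₂)`: a non-empty finite set of pips together with a horizontal and a
vertical set of permitted ordered pairs of pips. -/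
structure DominoSet where
  /-- the set `𝒲` of pips -/
  Pip : Type u
  finite_pip : Finite Pip
  nonempty_pip : Nonempty Pip
  /-- the horizontal domino set `𝓡₁ ⊆ 𝒲²` -/
  horiz : Set (Pip × Pip)
  /-- the vertical domino set `𝓡₂ ⊆ 𝒲²` -/
  vert : Set (Pip × Pip)

/-- `T : Ω → 𝒲` is an `𝓡`-domino function on `Ω ⊆ ℤ²`: each horizontal (vertical) domino tile
`{s, s + e₁}` (`{s, s + e₂}`) contained in `Ω` carries a permitted pair of pips. -/
def DominoSet.IsDominoFunction (R : DominoSet.{u}) (Ω : Set (ℤ × ℤ)) (T : Ω → R.Pip) : Prop :=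
  (∀ s t : Ω, (t : ℤ × ℤ) = (s : ℤ × ℤ) + (1, 0) → (T s, T t) ∈ R.horiz) ∧
  (∀ s t : Ω, (t : ℤ × ℤ) = (s : ℤ × ℤ) + (0, 1) → (T s, T t) ∈ R.vert)

/-- The `𝓡`-domino problem is solvable on `Ω ⊆ ℤ²`. -/
def DominoSet.SolvableOn (R : DominoSet.{u}) (Ω : Set (ℤ × ℤ)) : Prop :=
  ∃ T : Ω → R.Pip, R.IsDominoFunction Ω T

/-- The quadrant `ℕ²` as a subset of the domino board `ℤ²`. -/
def natQuadrant : Set (ℤ × ℤ) := {s | 0 ≤ s.1 ∧ 0 ≤ s.2}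

/-- The rectangle `[(r₁, r₂), (t₁, t₂)]` in the domino board `ℤ²`. -/
def dominoRect (r t : ℤ × ℤ) : Set (ℤ × ℤ) :=
  {s | (r.1 ≤ s.1 ∧ s.1 ≤ t.1) ∧ (r.2 ≤ s.2 ∧ s.2 ≤ t.2)}

/-- The Sudoku board `{0, …, N - 1} × ℤ` of width `N`. -/
abbrev SudokuBoard (N : ℕ) : Type := Fin N × ℤ

/-- A Sudoku rule of width `N` and digit set `D`: a set of functions `{0, …, N - 1} → D`. -/
abbrev SudokuRule (N : ℕ) (D : Type v) : Type v := Set (Fin N → D)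

/-- `F` is an `S`-Sudoku solution: along each non-vertical line `{(n, j n + i)}`, with arbitrary
integer slope `j` and intercept `i`, the function `n ↦ F (n, j n + i)` lies in `S`. -/
def IsSudokuSolution {N : ℕ} {D : Type v} (S : SudokuRule N D) (F : SudokuBoard N → D) : Prop :=
  ∀ j i : ℤ, (fun n : Fin N => F (n, j * ((n : ℕ) : ℤ) + i)) ∈ S

/-- Every column `m ↦ F (n, m)` is a non-constant function on `ℤ`. -/
def HasNonconstantColumns {N : ℕ} {D : Type v} (F : SudokuBoard N → D) : Prop :=
  ∀ n : Fin N, ∃ m m' : ℤ, F (n, m) ≠ F (n, m')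

/-- The `p`-valuation of an integer, with `padicNu p 0 = ⊤`. -/
noncomputable def padicNu (p : ℕ) (n : ℤ) : ℕ∞ := emultiplicity (p : ℤ) n

/-- The integer `n / p ^ ν_p(n)` is non-zero modulo `p` when `n ≠ 0`. -/
theorem lastDigit_ne_zero (p : ℕ) [hp : Fact p.Prime] {n : ℤ} (hn : n ≠ 0) :
    ((n / (p : ℤ) ^ multiplicity (p : ℤ) n : ℤ) : ZMod p) ≠ 0 := by
  have hp' : Prime (p : ℤ) := Nat.prime_iff_prime_int.mp hp.out
  have hf : FiniteMultiplicity (p : ℤ) n :=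
    Int.finiteMultiplicity_iff.mpr ⟨by simpa using hp.out.ne_one, hn⟩
  obtain ⟨c, hc, hndvd⟩ := hf.exists_eq_pow_mul_and_not_dvd
  have h0 : (p : ℤ) ^ multiplicity (p : ℤ) n ≠ 0 := pow_ne_zero _ hp'.ne_zero
  have hq : n / (p : ℤ) ^ multiplicity (p : ℤ) n = c := Int.ediv_eq_of_eq_mul_right h0 hc
  rw [hq, Ne, ZMod.intCast_zmod_eq_zero_iff_dvd]
  exact hndvd

/-- The function `f_p` on the integers: the last non-zero digit of `n` in base `p`, that is
`n / p ^ ν_p(n)` modulo `p`, with the convention `f_p(0) = 1`. -/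
noncomputable def lastDigit (p : ℕ) [Fact p.Prime] (n : ℤ) : (ZMod p)ˣ :=
  open Classical in
  if hn : n = 0 then 1
  else Units.mk0 ((n / (p : ℤ) ^ multiplicity (p : ℤ) n : ℤ) : ZMod p) (lastDigit_ne_zero p hn)

/-- The affine form `n ↦ a n + b` does not vanish identically modulo `p`. -/
def NondegenerateMod (p : ℕ) (a b : ℤ) : Prop :=
  ¬ ((a : ZMod p) = 0 ∧ (b : ZMod p) = 0)

/-- The side length `t` of the rectangle, attached to the leading coefficient `a`: `1` if `ν_p(a) = 0`, and `0`
otherwise. -/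
noncomputable def rectSide (p : ℕ) (a : ℤ) : ℕ :=
  open Classical in if padicNu p a = 0 then 1 else 0

/-- The decorated `p₁ × p₂`-adic Sudoku rule `S^𝓡`, of width `p₁² p₂²` and digit set
`(ℤ/p₁ℤ)ˣ × (ℤ/p₂ℤ)ˣ × 𝒲`. In the last clause `(s₁, s₂)` is the pair of valuations
`(ν_{p₁}(a n + b), ν_{p₂}(a n + b))` when that pair lies in the rectangle. -/
def decoratedRule (p₁ p₂ : ℕ) [Fact p₁.Prime] [Fact p₂.Prime] (R : DominoSet.{u}) :
    SudokuRule (p₁ ^ 2 * p₂ ^ 2) ((ZMod p₁)ˣ × (ZMod p₂)ˣ × R.Pip) :=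
  {g | ∃ a b : ℤ, NondegenerateMod p₁ a b ∧ NondegenerateMod p₂ a b ∧
    ∃ T : dominoRect (0, 0) ((rectSide p₁ a : ℤ), (rectSide p₂ a : ℤ)) → R.Pip,
      R.IsDominoFunction _ T ∧
      ∀ n : Fin (p₁ ^ 2 * p₂ ^ 2),
        (padicNu p₁ (a * ((n : ℕ) : ℤ) + b) ≤ (rectSide p₁ a : ℕ∞) →
          (g n).1 = lastDigit p₁ (a * ((n : ℕ) : ℤ) + b)) ∧
        (padicNu p₂ (a * ((n : ℕ) : ℤ) + b) ≤ (rectSide p₂ a : ℕ∞) →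
          (g n).2.1 = lastDigit p₂ (a * ((n : ℕ) : ℤ) + b)) ∧
        (∀ (s₁ s₂ : ℕ)
          (hs : ((s₁ : ℤ), (s₂ : ℤ)) ∈
            dominoRect (0, 0) ((rectSide p₁ a : ℤ), (rectSide p₂ a : ℤ))),
          padicNu p₁ (a * ((n : ℕ) : ℤ) + b) = (s₁ : ℕ∞) →
          padicNu p₂ (a * ((n : ℕ) : ℤ) + b) = (s₂ : ℕ∞) →
          (g n).2.2 = T ⟨((s₁ : ℤ), (s₂ : ℤ)), hs⟩)}

/-! Given a tiling `T` of the quadrant, let `F₁`, `F₂` be the last non-zero digits of the height and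
`w` the value of `T` at the pair of its valuations. On a line the height is `g (a n + b)` with `a`,
`b` coprime. The common factor `g` merely shifts the origin of the tiling and multiplies the digits
by units, so the line obeys the rule (`mem_decoratedRule_of_quadrant`).

Conversely, for each prime `p`, a board that is affine modulo `p` along all lines, off the zeros, is
globally so (`IsLinewiseAffine.exists_affine`). Non-constant columns make the vertical coefficient
non-zero, so an integral shear moves the zeros to the heights divisible by `p`. The valuation-one
clause of the rule makes the vertical coefficient of the board on these heights non-zero in turn,
and the process repeats through any finite number of levels (`IsDigitBoard.exists_levels`). The
Chinese remainder theorem yields one shear for both primes.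

After this shear, `w` is constant on the heights of valuations exactly `(k, l)`; call the value `T k
l`. Suitable lines meet adjacent valuations, so neighbouring values form permitted dominoes
(`IsDecoratedBoard.exists_square`). Compactness passes from squares to the quadrant. -/

/-! ### From affine along lines to affine on the board -/

/-- Along each non-vertical line of the board of width `N`, the function `F` agrees with a non-zero
affine function modulo `p` wherever the latter does not vanish. -/
def IsLinewiseAffine (p N : ℕ) (F : ℕ → ℤ → ZMod p) : Prop :=
  ∀ j i : ℤ, ∃ a b : ZMod p, (a ≠ 0 ∨ b ≠ 0) ∧
    ∀ n < N, a * n + b ≠ 0 → F n (j * n + i) = a * n + b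

section AffineStructure

variable {p : ℕ} [Fact p.Prime] {N : ℕ} {F : ℕ → ℤ → ZMod p}

theorem affine_coeff_unique {K : Type*} [Field K] {a b c d x y : K} (hxy : x ≠ y)
    (hx : a * x + b = c * x + d) (hy : a * y + b = c * y + d) : a = c ∧ b = d := by
  have h : (a - c) * (x - y) = 0 := by linear_combination hx - hy
  have hac : a = c := by
    rcases mul_eq_zero.mp h with h | h
    · exact sub_eq_zero.mp h
    · exact absurd (sub_eq_zero.mp h) hxy
  subst hac
  exact ⟨rfl, by linear_combination hx⟩

theorem affine_ne_zero_of_eq_zero {K : Type*} [Field K] {a b x y : K} (hab : a ≠ 0 ∨ b ≠ 0)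
    (hxy : x ≠ y) (hx : a * x + b = 0) : a * y + b ≠ 0 := by
  intro hy
  have := affine_coeff_unique (c := 0) (d := 0) hxy (by simpa using hx) (by simpa using hy)
  tauto

/-- An affine function which agrees with `F` at three points of a line agrees with `F` along this
line wherever it does not vanish. -/
theorem IsLinewiseAffine.of_three (hF : IsLinewiseAffine p N F) {j i : ℤ} {α β : ZMod p}
    {n₁ n₂ n₃ : ℕ} (l₁ : n₁ < N) (l₂ : n₂ < N) (l₃ : n₃ < N)
    (h₁₂ : (n₁ : ZMod p) ≠ n₂) (h₁₃ : (n₁ : ZMod p) ≠ n₃) (h₂₃ : (n₂ : ZMod p) ≠ n₃)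
    (e₁ : F n₁ (j * n₁ + i) = α * n₁ + β) (e₂ : F n₂ (j * n₂ + i) = α * n₂ + β)
    (e₃ : F n₃ (j * n₃ + i) = α * n₃ + β) :
    ∀ n < N, α * n + β ≠ 0 → F n (j * n + i) = α * n + β := by
  obtain ⟨a, b, hab, h⟩ := hF j i
  suffices hs : a = α ∧ b = β by
    obtain ⟨rfl, rfl⟩ := hs
    exact h
  by_cases z₁ : a * n₁ + b = 0
  · have z₂ := affine_ne_zero_of_eq_zero hab h₁₂ z₁
    have z₃ := affine_ne_zero_of_eq_zero hab h₁₃ z₁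
    exact affine_coeff_unique h₂₃ ((h _ l₂ z₂).symm.trans e₂) ((h _ l₃ z₃).symm.trans e₃)
  by_cases z₂ : a * n₂ + b = 0
  · have z₃ := affine_ne_zero_of_eq_zero hab h₂₃ z₂
    exact affine_coeff_unique h₁₃ ((h _ l₁ z₁).symm.trans e₁) ((h _ l₃ z₃).symm.trans e₃)
  · exact affine_coeff_unique h₁₂ ((h _ l₁ z₁).symm.trans e₁) ((h _ l₂ z₂).symm.trans e₂)

/-- A non-zero affine function vanishes at no more than one of four distinct residues, so three
points remain for `IsLinewiseAffine.of_three`. Four points thus suffice even when the values at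
zeros are unknown. -/
theorem IsLinewiseAffine.of_four (hF : IsLinewiseAffine p N F) {j i : ℤ} {α β : ZMod p}
    {u : Fin 4 → ℕ} (hu : ∀ k, u k < N) (hinj : Function.Injective fun k => (u k : ZMod p))
    (h : ∀ k, α * u k + β ≠ 0 → F (u k) (j * u k + i) = α * u k + β) :
    ∀ n < N, α * n + β ≠ 0 → F n (j * n + i) = α * n + β := by
  intro n hn hne
  have hab : α ≠ 0 ∨ β ≠ 0 := by
    by_contra hc
    push Not at hc
    simp [hc.1, hc.2] at hne
  have hd : ∀ k l : Fin 4, k ≠ l → (u k : ZMod p) ≠ u l := fun k l hkl he => hkl (hinj he)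
  have key : ∃ k : Fin 4, ∀ l, l ≠ k → α * u l + β ≠ 0 := by
    by_cases hz : ∃ k, α * u k + β = 0
    · obtain ⟨k, hk⟩ := hz
      exact ⟨k, fun l hl => affine_ne_zero_of_eq_zero hab (hd k l hl.symm) hk⟩
    · push Not at hz
      exact ⟨0, fun l _ => hz l⟩
  obtain ⟨k, hk⟩ := key
  obtain ⟨x, y, z, hx, hy, hz, hxy, hxz, hyz⟩ :
      ∃ x y z : Fin 4, x ≠ k ∧ y ≠ k ∧ z ≠ k ∧ x ≠ y ∧ x ≠ z ∧ y ≠ z := by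
    clear hk
    revert k
    decide
  exact hF.of_three (hu x) (hu y) (hu z) (hd _ _ hxy) (hd _ _ hxz) (hd _ _ hyz)
    (h x (hk x hx)) (h y (hk y hy)) (h z (hk z hz)) n hn hne

theorem natCast_add_mul_injective {u : Fin 4 → ℕ} (hu : Function.Injective u)
    (hlt : ∀ k, u k < p) (x ε : ZMod p) (hε : ε ≠ 0) :
    Function.Injective fun k => x + ε * (u k : ZMod p) := by
  intro k l hkl
  have h : (u k : ZMod p) = u l := mul_left_cancel₀ hε (add_left_cancel hkl)
  rw [ZMod.natCast_eq_natCast_iff'] at h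
  rw [Nat.mod_eq_of_lt (hlt k), Nat.mod_eq_of_lt (hlt l)] at h
  exact hu h

/-- Four known rows at heights `m + j c`, with four different `c` between `1` and `7`, determine the
row at height `m`. -/
theorem IsLinewiseAffine.row_of_four (hF : IsLinewiseAffine p N F) (hp : 7 < p) (hN : 14 < N)
    {A B C : ZMod p} {c : Fin 4 → ℕ} (hc : Function.Injective c)
    (hc7 : ∀ k, c k ≤ 7) (j m : ℤ)
    (h : ∀ k, ∀ n < N, A * n + B * ((m + j * c k : ℤ) : ZMod p) + C ≠ 0 →
      F n (m + j * c k) = A * n + B * ((m + j * c k : ℤ) : ZMod p) + C) :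
    ∀ n < N, A * n + B * (m : ZMod p) + C ≠ 0 → F n m = A * n + B * (m : ZMod p) + C := by
  intro n hn hne
  have hlt : ∀ k, c k < p := fun k => (hc7 k).trans_lt hp
  -- The four known rows are met by a line through `(n, m)`: of slope `j` to the right if there is
  -- room, otherwise of slope `-j` to the left.
  by_cases hbig : n + 7 < N
  · have hm : m = j * (n : ℤ) + (m - j * n) := by ring
    have hl : ∀ x : ℕ, (A + B * j) * (x : ZMod p) + (B * (m - j * n) + C)
        = A * x + B * ((j * (x : ℤ) + (m - j * n) : ℤ) : ZMod p) + C := by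
      intro x; push_cast; ring
    have := hF.of_four (j := j) (i := m - j * n) (α := A + B * j) (β := B * (m - j * n) + C)
      (u := fun k => n + c k) (fun k => by have := hc7 k; omega)
      (by simpa using natCast_add_mul_injective hc hlt (n : ZMod p) 1 one_ne_zero)
      (fun k => by
        have e : j * ((n + c k : ℕ) : ℤ) + (m - j * n) = m + j * c k := by push_cast; ring
        rw [hl, e]
        exact h k _ (by have := hc7 k; omega)) n hn
    rw [hl, ← hm] at this
    exact this hne
  · have hm : m = (-j) * (n : ℤ) + (m + j * n) := by ring
    have hl : ∀ x : ℕ, (A - B * j) * (x : ZMod p) + (B * (m + j * n) + C)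
        = A * x + B * (((-j) * (x : ℤ) + (m + j * n) : ℤ) : ZMod p) + C := by
      intro x; push_cast; ring
    have hle : ∀ k, c k ≤ n := fun k => by have := hc7 k; omega
    have := hF.of_four (j := -j) (i := m + j * n) (α := A - B * j) (β := B * (m + j * n) + C)
      (u := fun k => n - c k) (fun k => by omega)
      (by
        have := natCast_add_mul_injective hc hlt (n : ZMod p) (-1) (by simp)
        simpa [Nat.cast_sub (hle _), sub_eq_add_neg] using this)
      (fun k => by
        have e : (-j) * ((n - c k : ℕ) : ℤ) + (m + j * n) = m + j * c k := by
          rw [Nat.cast_sub (hle k)]; ring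
        rw [hl, e]
        exact h k _ (by omega)) n hn
    rw [hl, ← hm] at this
    exact this hne

theorem card_affine_eq_zero_le_one (a b : ZMod p) (hab : a ≠ 0 ∨ b ≠ 0) (s : ℕ) :
    ((Finset.range p).filter fun n : ℕ => a * ((n + s : ℕ) : ZMod p) + b = 0).card ≤ 1 := by
  rw [Finset.card_le_one]
  intro x hx y hy
  simp only [Finset.mem_filter, Finset.mem_range] at hx hy
  by_contra hne
  refine affine_ne_zero_of_eq_zero hab ?_ hx.2 hy.2
  intro h
  push_cast at h
  have h := add_right_cancel h
  rw [ZMod.natCast_eq_natCast_iff', Nat.mod_eq_of_lt hx.1, Nat.mod_eq_of_lt hy.1] at h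
  exact hne h

/-- Sixteen lines in a fixed configuration can be moved so that none of the affine functions
attached to them vanishes in three given consecutive columns. -/
theorem exists_nonvanishing_configuration (hp : 48 < p) (a b : ℤ → ℤ → ZMod p)
    (hab : ∀ j i, a j i ≠ 0 ∨ b j i ≠ 0) :
    ∃ n < p, ∃ m : ℤ, ∀ x y : Fin 4, ∀ s : Fin 3,
      a ((y : ℤ) - x) (m + 2 * x - ((y : ℤ) - x) * n) * ((n + s : ℕ) : ZMod p)
        + b ((y : ℤ) - x) (m + 2 * x - ((y : ℤ) - x) * n) ≠ 0 := by
  classical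
  by_contra! hcon
  -- There are `48 = 16 * 3` conditions, each failing for at most `M + 6 * p + 7` of the `p * M`
  -- positions. This `M` makes `49 * M` exceed `48 * (M + 6 * p + 7)`.
  set M : ℕ := 48 * (6 * p + 7) + 1 with hM
  let S : Finset (ℕ × ℕ) := Finset.range p ×ˢ Finset.range M
  let f : Fin 4 × Fin 4 → ℕ × ℕ → ℤ :=
    fun t u => (u.2 : ℤ) + 2 * (t.1 : ℕ) - (((t.2 : ℕ) : ℤ) - (t.1 : ℕ)) * (u.1 : ℕ)
  let bad : Fin 4 × Fin 4 → Fin 3 → ℕ × ℕ → Prop := fun t s u =>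
    a (((t.2 : ℕ) : ℤ) - (t.1 : ℕ)) (f t u) * ((u.1 + (s : ℕ) : ℕ) : ZMod p)
      + b (((t.2 : ℕ) : ℤ) - (t.1 : ℕ)) (f t u) = 0
  have hcover : S ⊆ (Finset.univ : Finset ((Fin 4 × Fin 4) × Fin 3)).biUnion
      fun ts => S.filter (bad ts.1 ts.2) := by
    intro u hu
    have hu' := hu
    simp only [S, Finset.mem_product, Finset.mem_range] at hu'
    obtain ⟨x, y, s, h⟩ := hcon u.1 hu'.1 u.2
    simp only [Finset.mem_biUnion, Finset.mem_univ, true_and, Finset.mem_filter]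
    exact ⟨((x, y), s), hu, h⟩
  -- The slope is fixed by `t`. For a given intercept the affine function has at most one zero among
  -- the `p` columns, and column and intercept determine `m`; so it is enough to count intercepts.
  have hone : ∀ t s, (S.filter (bad t s)).card ≤ M + 6 * p + 7 := by
    intro t s
    have h1 : (S.filter (bad t s)).card
        ≤ 1 * (Finset.Icc (-(3 * p : ℤ)) (M + 6 + 3 * p)).card := by
      refine Finset.card_le_mul_card_image_of_maps_to (f := f t) ?_ 1 ?_
      · intro u hu
        simp only [S, Finset.mem_filter, Finset.mem_product, Finset.mem_range] at hu
        obtain ⟨⟨h1, h2⟩, -⟩ := hu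
        have hx := t.1.isLt
        have hy := t.2.isLt
        have e1 : (((t.2 : ℕ) : ℤ) - (t.1 : ℕ)) ≤ 3 := by omega
        have e2 : -3 ≤ (((t.2 : ℕ) : ℤ) - (t.1 : ℕ)) := by omega
        have e3 : (((t.2 : ℕ) : ℤ) - (t.1 : ℕ)) * (u.1 : ℕ) ≤ 3 * p := by nlinarith
        have e4 : -(3 * p : ℤ) ≤ (((t.2 : ℕ) : ℤ) - (t.1 : ℕ)) * (u.1 : ℕ) := by nlinarith
        simp only [f, Finset.mem_Icc]
        constructor <;> omega
      · intro i _
        refine le_trans ?_ (card_affine_eq_zero_le_one _ _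
          (hab (((t.2 : ℕ) : ℤ) - (t.1 : ℕ)) i) (s : ℕ))
        refine Finset.card_le_card_of_injOn Prod.fst ?_ ?_
        · intro u hu
          simp only [S, Finset.coe_filter, Finset.mem_filter, Finset.mem_product, Finset.mem_range,
            Set.mem_ofPred_eq] at hu ⊢
          obtain ⟨⟨⟨h1, -⟩, h2⟩, rfl⟩ := hu
          exact ⟨h1, h2⟩
        · intro u hu v hv huv
          simp only [S, Finset.coe_filter, Finset.mem_filter, Set.mem_ofPred_eq] at hu hv
          have h := hu.2.trans hv.2.symm
          simp only [f, huv] at h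
          exact Prod.ext huv (by omega)
    simp only [Int.card_Icc, one_mul] at h1
    omega
  have hfin : p * M ≤ 48 * (M + 6 * p + 7) := by
    calc p * M = S.card := by simp [S]
      _ ≤ _ := Finset.card_le_card hcover
      _ ≤ (Finset.univ : Finset ((Fin 4 × Fin 4) × Fin 3)).card * (M + 6 * p + 7) :=
          Finset.card_biUnion_le_card_mul _ _ _ fun ts _ => hone ts.1 ts.2
      _ = 48 * (M + 6 * p + 7) := by simp
  have : 49 * M ≤ p * M := Nat.mul_le_mul_right _ hp
  omega

/-- A function which is affine modulo `p` along each line, in the sense of `IsLinewiseAffine`, is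
affine on the whole board. -/
theorem IsLinewiseAffine.exists_affine (hF : IsLinewiseAffine p N F) (hp : 48 < p)
    (hN : p + 2 ≤ N) (h0 : ∀ n m, F n m ≠ 0) :
    ∃ A B C : ZMod p, (A ≠ 0 ∨ B ≠ 0 ∨ C ≠ 0) ∧ ∀ n < N, ∀ m : ℤ,
      A * n + B * (m : ZMod p) + C ≠ 0 → F n m = A * n + B * (m : ZMod p) + C := by
  have hF' := hF
  choose a b hab h using hF'
  obtain ⟨n, hn, m, hnm⟩ := exists_nonvanishing_configuration hp a b hab
  have h2 : (2 : ZMod p) ≠ 0 := by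
    intro h
    have : ((2 : ℕ) : ZMod p) = 0 := by exact_mod_cast h
    rw [ZMod.natCast_eq_zero_iff] at this
    have := Nat.le_of_dvd (by norm_num) this
    omega
  -- The middle one of three equally spaced points of a line carries the mean of the outer values,
  -- as no zero occurs there.
  have hrel : ∀ x y : ℕ, x < 4 → y < 4 →
      F n (m + 2 * x) + F (n + 2) (m + 2 * y) = 2 * F (n + 1) (m + (x + y)) := by
    intro x y hx hy
    have hh := hnm ⟨x, hx⟩ ⟨y, hy⟩
    have e0 := h _ _ _ (by omega) (hh 0)
    have e1 := h _ _ _ (by omega) (hh 1)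
    have e2 := h _ _ _ (by omega) (hh 2)
    simp only [Fin.val_zero, Fin.val_one, Fin.val_two] at e0 e1 e2
    have r0 : ((y : ℤ) - x) * ((n + 0 : ℕ) : ℤ) + (m + 2 * x - ((y : ℤ) - x) * n)
      = m + 2 * x := by push_cast; ring
    have r1 : ((y : ℤ) - x) * ((n + 1 : ℕ) : ℤ) + (m + 2 * x - ((y : ℤ) - x) * n)
      = m + (x + y) := by push_cast; ring
    have r2 : ((y : ℤ) - x) * ((n + 2 : ℕ) : ℤ) + (m + 2 * x - ((y : ℤ) - x) * n)
      = m + 2 * y := by push_cast; ring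
    rw [r0] at e0
    rw [r1] at e1
    rw [r2] at e2
    rw [show F n (m + 2 * x) = _ from e0, e1, e2]
    push_cast
    ring
  set A := (F (n + 2) m - F n m) / 2 with hA
  set B := (F n (m + 2) - F n m) / 2 with hB
  have hA2 : 2 * A = F (n + 2) m - F n m := by rw [hA]; field_simp
  have hB2 : 2 * B = F n (m + 2) - F n m := by rw [hB]; field_simp
  -- The right side of `hrel` depends on `x + y` only. Moving a unit between `x` and `y` shows that
  -- both outer columns have the same constant increment `2 * B`.
  have hf : ∀ x : ℕ, x < 4 → F n (m + 2 * x) = F n m + 2 * B * x ∧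
      F (n + 2) (m + 2 * x) = F n m + 2 * A + 2 * B * x := by
    intro x
    induction x with
    | zero => intro _; constructor <;> simp [hA2]
    | succ x ih =>
      intro hx
      obtain ⟨ih1, ih2⟩ := ih (by omega)
      have r1 := hrel (x + 1) 0 hx (by omega)
      have r2 := hrel x 1 (by omega) (by omega)
      have r3 := hrel 0 (x + 1) (by omega) hx
      have r4 := hrel 1 x (by omega) (by omega)
      have r5 := hrel 0 1 (by omega) (by omega)
      have r6 := hrel 1 0 (by omega) (by omega)
      push_cast at r1 r2 r3 r4 r5 r6 ⊢
      simp only [add_zero, zero_add] at r1 r2 r3 r4 r5 r6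
      rw [add_comm (1 : ℤ) (x : ℤ)] at r4
      constructor
      · linear_combination r1 - r2 + r5 - r6 + ih1 - hB2
      · linear_combination r3 - r4 + ih2 - hB2
  have hg : ∀ x : ℕ, x < 4 → F (n + 1) (m + 2 * x) = F n m + A + 2 * B * x := by
    intro x hx
    have r := hrel x x hx hx
    rw [(hf x hx).1, (hf x hx).2, ← two_mul] at r
    refine mul_left_cancel₀ h2 ?_
    linear_combination -r
  set C := F n m - A * n - B * m with hC
  have hne : ∀ d : ℕ, 0 < d → d < 3 → (d : ZMod p) ≠ 0 := by
    intro d hd hd3 h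
    rw [ZMod.natCast_eq_zero_iff] at h
    have := Nat.le_of_dvd hd h
    omega
  let Known : ℤ → Prop := fun r => ∀ k < N, A * k + B * (r : ZMod p) + C ≠ 0 →
    F k r = A * k + B * (r : ZMod p) + C
  have hstart : ∀ x : ℕ, x < 4 → Known (m + 2 * x) := by
    intro x hx
    have := hF.of_three (j := 0) (i := m + 2 * x) (α := A)
      (β := B * ((m + 2 * x : ℤ) : ZMod p) + C) (n₁ := n) (n₂ := n + 1) (n₃ := n + 2)
      (by omega) (by omega) (by omega) (by simp)
      (by have := hne 2 (by norm_num) (by norm_num); push_cast; simpa using this)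
      (by
        push_cast
        intro h
        exact one_ne_zero (α := ZMod p) (by linear_combination -h))
      (by rw [zero_mul, zero_add, (hf x hx).1, hC]; push_cast; ring)
      (by rw [zero_mul, zero_add, hg x hx, hC]; push_cast; ring)
      (by rw [zero_mul, zero_add, (hf x hx).2, hC]; push_cast; ring)
    intro k hk
    simpa only [zero_mul, zero_add, ← add_assoc] using this k hk
  have hstep : ∀ (c : Fin 4 → ℕ), Function.Injective c → (∀ k, c k ≤ 7) → ∀ j r : ℤ,
      (∀ k, Known (r + j * c k)) → Known r := fun c hc hc7 j r h =>
    hF.row_of_four (by omega) (by omega) hc hc7 j r h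
  have hcons : Function.Injective (fun k : Fin 4 => (k : ℕ) + 1) ∧
      ∀ k : Fin 4, (k : ℕ) + 1 ≤ 7 := by decide
  have hodd : Function.Injective (fun k : Fin 4 => 2 * (k : ℕ) + 1) ∧
      ∀ k : Fin 4, 2 * (k : ℕ) + 1 ≤ 7 := by decide
  have hup : ∀ t : ℕ, Known (m + 2 * t) := by
    intro t
    induction t using Nat.strong_induction_on with
    | _ t ih =>
      by_cases ht : t < 4
      · exact hstart t ht
      · refine hstep _ hcons.1 hcons.2 (-2) _ fun k => ?_
        have := ih (t - (k + 1)) (by omega)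
        convert this using 1
        have := k.isLt
        push_cast [Nat.cast_sub (show (k : ℕ) + 1 ≤ t by omega)]
        ring
  have heven : ∀ t : ℤ, Known (m + 2 * t) := by
    have hdown : ∀ t s : ℕ, Known (m + 2 * ((s : ℤ) - t)) := by
      intro t
      induction t with
      | zero => intro s; simpa using hup s
      | succ t ih =>
        intro s
        refine hstep _ hcons.1 hcons.2 2 _ fun k => ?_
        convert ih (s + k) using 1
        push_cast
        ring
    intro t
    have := hdown t.natAbs (t + t.natAbs).toNat
    rwa [Int.toNat_of_nonneg (by omega), add_sub_cancel_right] at this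
  refine ⟨A, B, C, ?_, ?_⟩
  -- By the choice of `C` the affine function takes the value `F n m ≠ 0` at `(n, m)`.
  · by_contra hc
    push Not at hc
    have := h0 n m
    rw [show F n m = C + A * n + B * m by rw [hC]; ring] at this
    simp [hc.1, hc.2.1, hc.2.2] at this
  · intro k hk r
    refine (?_ : Known r) k hk
    rcases Int.even_or_odd' (r - m) with ⟨t, ht | ht⟩
    · convert heven t using 1
      omega
    -- A row at odd distance from `m` is reached along slope one from the rows 1, 3, 5 and 7 above
    -- it, which are at even distance.
    · refine hstep _ hodd.1 hodd.2 1 _ fun k => ?_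
      convert heven (t + k + 1) using 1
      push_cast
      linarith

end AffineStructure

/-! ### Digit boards and their normalization at successive levels -/

/-- On `{0, …, N - 1}`, the values of `f` are the last non-zero base `p` digits of `a n + b`, as far
as the valuations zero and, if `p ∤ a`, one are concerned. -/
def IsDigitLine (p N : ℕ) (f : ℕ → ZMod p) (a b : ℤ) : Prop :=
  ¬((p : ℤ) ∣ a ∧ (p : ℤ) ∣ b) ∧
  (∀ n < N, ¬(p : ℤ) ∣ a * n + b → f n = ((a * n + b : ℤ) : ZMod p)) ∧
  (¬(p : ℤ) ∣ a → ∀ n < N, ∀ c : ℤ, a * n + b = p * c → ¬(p : ℤ) ∣ c → f n = (c : ZMod p))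

/-- Each non-vertical line of the board is a line of last non-zero digits. -/
def IsDigitBoard (p N : ℕ) (F : ℕ → ℤ → ZMod p) : Prop :=
  (∀ n m, F n m ≠ 0) ∧ ∀ j i : ℤ, ∃ a b : ℤ, IsDigitLine p N (fun n => F n (j * n + i)) a b

/-- `F` is `B` times the second coordinate wherever this coordinate is not divisible by `p`. -/
def IsNormalized (p N : ℕ) (F : ℕ → ℤ → ZMod p) (B : ZMod p) : Prop :=
  B ≠ 0 ∧ ∀ n < N, ∀ m : ℤ, ¬(p : ℤ) ∣ m → F n m = B * m

/-- Each predicate excludes at most one of four columns. With `P`, `Q` the vanishing of two affine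
functions, two columns remain in which both can be read off. -/
theorem exists_two_avoiding (P Q : ℕ → Prop) (hP : ∀ x < 4, ∀ y < 4, P x → P y → x = y)
    (hQ : ∀ x < 4, ∀ y < 4, Q x → Q y → x = y) :
    ∃ x y, x < y ∧ y < 4 ∧ ¬P x ∧ ¬Q x ∧ ¬P y ∧ ¬Q y := by
  by_contra! h
  have h01 := h 0 1 (by omega) (by omega)
  have h02 := h 0 2 (by omega) (by omega)
  have h03 := h 0 3 (by omega) (by omega)
  have h12 := h 1 2 (by omega) (by omega)
  have h13 := h 1 3 (by omega) (by omega)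
  have h23 := h 2 3 (by omega) (by omega)
  have p01 := hP 0 (by omega) 1 (by omega)
  have p02 := hP 0 (by omega) 2 (by omega)
  have p03 := hP 0 (by omega) 3 (by omega)
  have p12 := hP 1 (by omega) 2 (by omega)
  have p13 := hP 1 (by omega) 3 (by omega)
  have p23 := hP 2 (by omega) 3 (by omega)
  have q01 := hQ 0 (by omega) 1 (by omega)
  have q02 := hQ 0 (by omega) 2 (by omega)
  have q03 := hQ 0 (by omega) 3 (by omega)
  have q12 := hQ 1 (by omega) 2 (by omega)
  have q13 := hQ 1 (by omega) 3 (by omega)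
  have q23 := hQ 2 (by omega) 3 (by omega)
  clear h hP hQ
  grind +splitImp

theorem IsDigitBoard.comp_affine {p N : ℕ} {F : ℕ → ℤ → ZMod p}
    (h : IsDigitBoard p N F) (X Y D : ℤ) :
    IsDigitBoard p N fun n m => F n (X * n + Y + D * m) := by
  refine ⟨fun n m => h.1 _ _, fun j i => ?_⟩
  obtain ⟨a, b, hab⟩ := h.2 (X + D * j) (Y + D * i)
  refine ⟨a, b, ?_⟩
  convert hab using 3
  ring

section DigitBoard

variable {p : ℕ} [Fact p.Prime] {N : ℕ} {F : ℕ → ℤ → ZMod p}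

theorem intCast_ne_zero_iff_not_dvd {x : ℤ} : (x : ZMod p) ≠ 0 ↔ ¬(p : ℤ) ∣ x :=
  (ZMod.intCast_zmod_eq_zero_iff_dvd x p).not

theorem natCast_inj_of_lt_four (hp : 4 < p) {x y : ℕ} (hx : x < 4) (hy : y < 4)
    (h : (x : ZMod p) = y) : x = y := by
  rwa [ZMod.natCast_eq_natCast_iff', Nat.mod_eq_of_lt (by omega), Nat.mod_eq_of_lt (by omega)] at h

theorem eq_of_affine_eq_zero (hp : 4 < p) {a b : ZMod p} (hab : a ≠ 0 ∨ b ≠ 0) :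
    ∀ x < 4, ∀ y < 4, a * (x : ℕ) + b = 0 → a * (y : ℕ) + b = 0 → x = y := by
  intro x hx y hy h1 h2
  by_contra hne
  exact affine_ne_zero_of_eq_zero hab
    (fun h => hne (natCast_inj_of_lt_four hp hx hy h)) h1 h2

theorem IsDigitLine.cast_ne_zero {f : ℕ → ZMod p} {a b : ℤ} (h : IsDigitLine p N f a b) :
    (a : ZMod p) ≠ 0 ∨ (b : ZMod p) ≠ 0 := by
  rw [intCast_ne_zero_iff_not_dvd, intCast_ne_zero_iff_not_dvd]
  exact not_and_or.mp h.1

theorem IsDigitLine.eq_of_ne_zero {f : ℕ → ZMod p} {a b : ℤ} (h : IsDigitLine p N f a b) {n : ℕ}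
    (hn : n < N) (hne : (a : ZMod p) * n + b ≠ 0) : f n = a * n + b := by
  have e : ((a * n + b : ℤ) : ZMod p) = a * n + b := by push_cast; rfl
  rw [← e] at hne ⊢
  exact h.2.1 n hn (intCast_ne_zero_iff_not_dvd.mp hne)

theorem IsDigitLine.coeff_eq {f : ℕ → ZMod p} {a b : ℤ} (h : IsDigitLine p N f a b) (hp : 4 < p)
    (hN : 4 ≤ N) {α β : ZMod p} (hαβ : α ≠ 0 ∨ β ≠ 0)
    (hf : ∀ n < N, α * n + β ≠ 0 → f n = α * n + β) : (a : ZMod p) = α ∧ (b : ZMod p) = β := by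
  obtain ⟨x, y, hxy, hy, hx1, hx2, hy1, hy2⟩ := exists_two_avoiding
    (fun x => (a : ZMod p) * (x : ℕ) + b = 0) (fun x => α * (x : ℕ) + β = 0)
    (eq_of_affine_eq_zero hp h.cast_ne_zero) (eq_of_affine_eq_zero hp hαβ)
  refine affine_coeff_unique (x := (x : ZMod p)) (y := (y : ZMod p)) ?_ ?_ ?_
  · intro hc
    exact hxy.ne (natCast_inj_of_lt_four hp (by omega) hy hc)
  · rw [← hf x (by omega) hx2, h.eq_of_ne_zero (by omega) hx1]
  · rw [← hf y (by omega) hy2, h.eq_of_ne_zero (by omega) hy1]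

theorem IsDigitBoard.isLinewiseAffine (h : IsDigitBoard p N F) : IsLinewiseAffine p N F := by
  intro j i
  obtain ⟨a, b, hab⟩ := h.2 j i
  exact ⟨a, b, hab.cast_ne_zero, fun n hn hne => hab.eq_of_ne_zero hn hne⟩

/-- Integer lifts of `-A / B` and `-C / B` give a shear along the zero line of the affine function.
-/
theorem exists_normalized_of_affine {A B C : ZMod p} (hB : B ≠ 0)
    (h : ∀ n < N, ∀ m : ℤ, A * n + B * (m : ZMod p) + C ≠ 0 →
      F n m = A * n + B * (m : ZMod p) + C) :
    ∃ J I : ℤ, IsNormalized p N (fun n m => F n (J * n + I + m)) B := by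
  obtain ⟨J, hJ⟩ := ZMod.intCast_surjective (-A / B)
  obtain ⟨I, hI⟩ := ZMod.intCast_surjective (-C / B)
  refine ⟨J, I, hB, fun n hn m hm => ?_⟩
  have e : A * n + B * ((J * n + I + m : ℤ) : ZMod p) + C = B * m := by
    push_cast
    rw [hJ, hI]
    field_simp
    ring
  have := h n hn (J * n + I + m)
  rw [e] at this
  exact this (mul_ne_zero hB (intCast_ne_zero_iff_not_dvd.mpr hm))

theorem IsNormalized.add_multiple {B : ZMod p} (h : IsNormalized p N F B) (g : ℕ → ℤ) :
    IsNormalized p N (fun n m => F n (m + p * g n)) B := by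
  refine ⟨h.1, fun n hn m hm => ?_⟩
  change F n (m + p * g n) = _
  rw [h.2 n hn _ (by rwa [dvd_add_left (dvd_mul_right _ _)])]
  push_cast
  simp

theorem IsNormalized.comp_mul {B : ZMod p} (h : IsNormalized p N F B) {d : ℤ}
    (hd : ¬(p : ℤ) ∣ d) : IsNormalized p N (fun n m => F n (d * m)) (B * d) := by
  have hp : Prime (p : ℤ) := Nat.prime_iff_prime_int.mp Fact.out
  refine ⟨mul_ne_zero h.1 (intCast_ne_zero_iff_not_dvd.mpr hd), fun n hn m hm => ?_⟩
  change F n (d * m) = _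
  rw [h.2 n hn _ (fun hc => (hp.dvd_or_dvd hc).elim hd hm)]
  push_cast
  ring

/-- In a normalized board, a line which has a point at height prime to `p` is, modulo `p`, described
by its slope and its intercept. -/
theorem IsDigitLine.coeff_eq_of_normalized {B : ZMod p} (h : IsNormalized p N F B) (hp : 4 < p)
    (hN : 4 ≤ N) {j i a b : ℤ} (hl : IsDigitLine p N (fun n => F n (j * n + i)) a b) {n : ℕ}
    (hn : ¬(p : ℤ) ∣ j * n + i) : (a : ZMod p) = B * j ∧ (b : ZMod p) = B * i := by
  have e : ∀ n : ℕ, B * j * (n : ZMod p) + B * i = B * ((j * n + i : ℤ) : ZMod p) := by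
    intro n; push_cast; ring
  refine hl.coeff_eq hp hN ?_ fun n hn hne => ?_
  · by_contra hc
    push Not at hc
    have := e n
    rw [hc.1, hc.2, zero_mul, zero_add] at this
    exact mul_ne_zero h.1 (intCast_ne_zero_iff_not_dvd.mpr hn) this.symm
  · rw [e] at hne ⊢
    exact h.2 n hn _ (intCast_ne_zero_iff_not_dvd.mp (right_ne_zero_of_mul hne))

theorem IsDigitLine.dvd_iff_of_normalized {B : ZMod p} (h : IsNormalized p N F B) (hp : 4 < p)
    (hN : 4 ≤ N) {j i a b : ℤ} (hl : IsDigitLine p N (fun n => F n (j * n + i)) a b) {n₀ : ℕ}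
    (hn₀ : ¬(p : ℤ) ∣ j * n₀ + i) (n : ℕ) : (p : ℤ) ∣ a * n + b ↔ (p : ℤ) ∣ j * n + i := by
  obtain ⟨ha, hb⟩ := hl.coeff_eq_of_normalized h hp hN hn₀
  have e : ((a * n + b : ℤ) : ZMod p) = B * ((j * n + i : ℤ) : ZMod p) := by
    push_cast; rw [ha, hb]; ring
  rw [← ZMod.intCast_zmod_eq_zero_iff_dvd, ← ZMod.intCast_zmod_eq_zero_iff_dvd, e, mul_eq_zero]
  simp [h.1]

/-- The points of a normalized board at heights divisible by `p` form a board which can again be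
normalized. -/
theorem IsDigitBoard.exists_next (hF : IsDigitBoard p N F) (hp : 48 < p) (hN : p * p ≤ N)
    {B : ZMod p} (hB : IsNormalized p N F B) :
    ∃ J I : ℤ, ∃ B' : ZMod p, IsNormalized p N (fun n m => F n (p * (J * n + I + m))) B' := by
  have hpN : 48 * p ≤ N := le_trans (Nat.mul_le_mul_right p hp.le) hN
  have hF' : IsDigitBoard p N fun n m => F n (p * m) := by
    simpa using hF.comp_affine 0 0 p
  obtain ⟨A, B', C, hABC, h⟩ := hF'.isLinewiseAffine.exists_affine hp (by omega) hF'.1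
  suffices hB' : B' ≠ 0 by
    obtain ⟨J, I, hJI⟩ := exists_normalized_of_affine hB' h
    exact ⟨J, I, B', hJI⟩
  -- If `B'` vanished, heights divisible by `p` would carry values independent of the height. The
  -- line of slope one through `(n₀, 0)` contradicts this: at column `n₀ + p * k` its height is `p *
  -- k`, and the valuation-one clause gives the digit `a * k + c`, which varies with `k` as `p ∤ a`.
  rintro rfl
  have hAC : A ≠ 0 ∨ C ≠ 0 := by tauto
  obtain ⟨n₀, hn₀, hne⟩ : ∃ n₀ : ℕ, n₀ < 2 ∧ A * n₀ + C ≠ 0 := by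
    by_contra! hc
    have h0 := hc 0 (by norm_num)
    have h1 := hc 1 (by norm_num)
    exact affine_ne_zero_of_eq_zero hAC (by simp) h0 h1
  obtain ⟨a, b, hab⟩ := hF.2 1 (-n₀)
  have hp' : Prime (p : ℤ) := Nat.prime_iff_prime_int.mp Fact.out
  have hnd : ¬(p : ℤ) ∣ 1 * ((n₀ + 1 : ℕ) : ℤ) + -n₀ := by
    intro hd
    exact hp'.not_isUnit (isUnit_of_dvd_one (by simpa using hd))
  obtain ⟨ha, -⟩ := hab.coeff_eq_of_normalized hB (by omega) (by omega) hnd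
  have ha0 : (a : ZMod p) ≠ 0 := by
    rw [ha]
    simpa using hB.1
  obtain ⟨c, hc⟩ : (p : ℤ) ∣ a * n₀ + b := by
    rw [hab.dvd_iff_of_normalized hB (by omega) (by omega) hnd]
    simp
  obtain ⟨x, y, hxy, hy, hx1, -, hy1, -⟩ := exists_two_avoiding
    (fun x => (a : ZMod p) * (x : ℕ) + c = 0) (fun x => (a : ZMod p) * (x : ℕ) + c = 0)
    (eq_of_affine_eq_zero (by omega) (.inl ha0)) (eq_of_affine_eq_zero (by omega) (.inl ha0))
  have key : ∀ k : ℕ, k < 4 → (a : ZMod p) * k + c ≠ 0 → A * n₀ + C = (a : ZMod p) * k + c := by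
    intro k hk hk0
    have e1 : ((a * k + c : ℤ) : ZMod p) = a * k + c := by push_cast; rfl
    have hlt : n₀ + p * k < N := by nlinarith
    have h1 := hab.2.2 (intCast_ne_zero_iff_not_dvd.mp ha0) (n₀ + p * k) hlt (a * k + c)
      (by push_cast; linear_combination hc)
      (intCast_ne_zero_iff_not_dvd.mp (by rwa [e1]))
    have h2 := h (n₀ + p * k) hlt k (by push_cast; simpa using hne)
    have e2 : 1 * ((n₀ + p * k : ℕ) : ℤ) + -(n₀ : ℤ) = p * k := by push_cast; ring
    dsimp only at h1
    rw [e2, h2, e1] at h1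
    push_cast at h1
    simpa using h1
  refine hxy.ne (natCast_inj_of_lt_four (p := p) (x := x) (by omega) (by omega) hy ?_)
  have := (key x (by omega) hx1).symm.trans (key y hy hy1)
  exact mul_left_cancel₀ ha0 (add_right_cancel this)

/-- At level `k < K` a change of the shear by multiples of `p ^ K` moves `m` by multiples of `p`.
Normalization up to level `K - 1` therefore depends on the shear modulo `p ^ K` only, which permits
later corrections and the use of the Chinese remainder theorem. -/
theorem IsNormalized.congr_affine {X Y X' Y' : ℤ} {k K : ℕ} (hk : k < K) {B : ZMod p}
    (h : IsNormalized p N (fun n m => F n (X * n + Y + (p : ℤ) ^ k * m)) B)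
    (hX : (p : ℤ) ^ K ∣ X' - X) (hY : (p : ℤ) ^ K ∣ Y' - Y) :
    IsNormalized p N (fun n m => F n (X' * n + Y' + (p : ℤ) ^ k * m)) B := by
  obtain ⟨x, hx⟩ := (pow_dvd_pow (p : ℤ) hk).trans hX
  obtain ⟨y, hy⟩ := (pow_dvd_pow (p : ℤ) hk).trans hY
  convert h.add_multiple (fun n => x * n + y) using 4 with n m
  rw [pow_succ] at hx hy
  linear_combination (n : ℤ) * hx + hy

/-- A board with a non-constant column can be normalized simultaneously at any finite number of
levels. -/
theorem IsDigitBoard.exists_levels (hF : IsDigitBoard p N F) (hp : 48 < p) (hN : p * p ≤ N)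
    (hcol : ∀ n < N, ∃ m m' : ℤ, F n m ≠ F n m') (K : ℕ) :
    ∃ X Y : ℤ, ∃ B : ℕ → ZMod p, ∀ k ≤ K,
      IsNormalized p N (fun n m => F n (X * n + Y + (p : ℤ) ^ k * m)) (B k) := by
  have hpN : 48 * p ≤ N := le_trans (Nat.mul_le_mul_right p hp.le) hN
  induction K with
  | zero =>
    obtain ⟨A, B, C, hABC, h⟩ := hF.isLinewiseAffine.exists_affine hp (by omega) hF.1
    -- Only here are non-constant columns used: with `B = 0`, a column where `A * n + C ≠ 0` would
    -- be constant.
    have hB : B ≠ 0 := by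
      rintro rfl
      have hAC : A ≠ 0 ∨ C ≠ 0 := by tauto
      obtain ⟨n, hn, hne⟩ : ∃ n : ℕ, n < 2 ∧ A * n + C ≠ 0 := by
        by_contra! hc
        have h0 := hc 0 (by norm_num)
        have h1 := hc 1 (by norm_num)
        exact affine_ne_zero_of_eq_zero hAC (by simp) h0 h1
      obtain ⟨m, m', hm⟩ := hcol n (by omega)
      apply hm
      rw [h n (by omega) m (by simpa using hne), h n (by omega) m' (by simpa using hne)]
      simp
    obtain ⟨X, Y, hXY⟩ := exists_normalized_of_affine hB h
    refine ⟨X, Y, fun _ => B, fun k hk => ?_⟩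
    obtain rfl : k = 0 := by omega
    simpa using hXY
  | succ K ih =>
    obtain ⟨X, Y, B, h⟩ := ih
    obtain ⟨J, I, B', h'⟩ :=
      (hF.comp_affine X Y ((p : ℤ) ^ K)).exists_next hp hN (h K le_rfl)
    refine ⟨X + p ^ (K + 1) * J, Y + p ^ (K + 1) * I, Function.update B (K + 1) B',
      fun k hk => ?_⟩
    rcases hk.eq_or_lt with rfl | hk
    · rw [Function.update_self]
      convert h' using 4
      ring
    · rw [Function.update_of_ne hk.ne]
      exact (h k (by omega)).congr_affine hk ⟨J, by ring⟩ ⟨I, by ring⟩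

end DigitBoard

/-! ### Decorated boards and the dominoes they contain -/

/-- On `{0, …, N - 1}`, the functions `f`, `g` are lines of digits of a common affine form, and `w`
is a function of the pair of valuations of this form which respects the relations `H` and `V`. -/
def IsDecoratedLine {W : Type*} (p q N : ℕ) (H V : W → W → Prop) (f : ℕ → ZMod p) (g : ℕ → ZMod q)
    (w : ℕ → W) : Prop :=
  ∃ a b : ℤ, IsDigitLine p N f a b ∧ IsDigitLine q N g a b ∧ ∃ t t₁ t₂ : W,
    (∀ n < N, ¬(p : ℤ) ∣ a * n + b → ¬(q : ℤ) ∣ a * n + b → w n = t) ∧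
    (¬(p : ℤ) ∣ a → H t t₁ ∧ ∀ n < N, ∀ c : ℤ, a * n + b = p * c → ¬(p : ℤ) ∣ c →
      ¬(q : ℤ) ∣ a * n + b → w n = t₁) ∧
    (¬(q : ℤ) ∣ a → V t t₂ ∧ ∀ n < N, ∀ c : ℤ, a * n + b = q * c → ¬(q : ℤ) ∣ c →
      ¬(p : ℤ) ∣ a * n + b → w n = t₂)

/-- Each non-vertical line of the board is a decorated line. -/
def IsDecoratedBoard {W : Type*} (p q N : ℕ) (H V : W → W → Prop) (F : ℕ → ℤ → ZMod p)
    (G : ℕ → ℤ → ZMod q) (w : ℕ → ℤ → W) : Prop :=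
  ∀ j i : ℤ, IsDecoratedLine p q N H V (fun n => F n (j * n + i)) (fun n => G n (j * n + i))
    (fun n => w n (j * n + i))

theorem not_dvd_of_pos_of_lt {p c : ℕ} (hc : 0 < c) (hcp : c < p) : ¬(p : ℤ) ∣ c := by
  rw [Int.natCast_dvd_natCast]
  exact Nat.not_dvd_of_pos_of_lt hc hcp

section DecoratedBoard

variable {W : Type*} {p q N : ℕ} {H V : W → W → Prop} {F : ℕ → ℤ → ZMod p} {G : ℕ → ℤ → ZMod q}
  {w : ℕ → ℤ → W}

/-- Exchanging the primes exchanges `H` and `V`, so vertical dominoes follow from the horizontal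
case. -/
theorem IsDecoratedBoard.symm (h : IsDecoratedBoard p q N H V F G w) :
    IsDecoratedBoard q p N V H G F w := by
  intro j i
  obtain ⟨a, b, hF, hG, t, t₁, t₂, h0, h1, h2⟩ := h j i
  exact ⟨a, b, hG, hF, t, t₂, t₁, fun n hn hq hp => h0 n hn hp hq, h2, h1⟩

theorem IsDecoratedBoard.comp_affine (h : IsDecoratedBoard p q N H V F G w) (X Y D : ℤ) :
    IsDecoratedBoard p q N H V (fun n m => F n (X * n + Y + D * m))
      (fun n m => G n (X * n + Y + D * m)) (fun n m => w n (X * n + Y + D * m)) := by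
  intro j i
  have e : ∀ n : ℕ, X * n + Y + D * (j * n + i) = (X + D * j) * n + (Y + D * i) := by
    intro n; ring
  simp only [e]
  exact h _ _

theorem IsDecoratedBoard.isDigitBoard (h : IsDecoratedBoard p q N H V F G w)
    (h0 : ∀ n m, F n m ≠ 0) : IsDigitBoard p N F := by
  refine ⟨h0, fun j i => ?_⟩
  obtain ⟨a, b, hF, -⟩ := h j i
  exact ⟨a, b, hF⟩

variable [Fact p.Prime] [Fact q.Prime] {B : ZMod p} {C : ZMod q}

/-- In a normalized decorated board, the decoration is constant on the points with height prime to
`p` and `q`. -/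
theorem IsDecoratedBoard.exists_const (h : IsDecoratedBoard p q N H V F G w) (hp : 4 < p)
    (hq : 4 < q) (hN : 4 ≤ N) (hF : IsNormalized p N F B) (hG : IsNormalized q N G C) :
    ∃ v, ∀ n < N, ∀ m : ℤ, ¬(p : ℤ) ∣ m → ¬(q : ℤ) ∣ m → w n m = v := by
  have hadj : ∀ n, n + 1 < N → ∀ m m' : ℤ, ¬(p : ℤ) ∣ m → ¬(q : ℤ) ∣ m → ¬(p : ℤ) ∣ m' →
      ¬(q : ℤ) ∣ m' → w n m = w (n + 1) m' := by
    intro n hn m m' hpm hqm hpm' hqm'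
    -- Points in adjacent columns always lie on a line of integer slope, along which all points
    -- prime to `p` and `q` carry the same pip.
    obtain ⟨a, b, hf, hg, t, t₁, t₂, h0, -⟩ := h (m' - m) (m - (m' - m) * n)
    have e : (m' - m) * (n : ℤ) + (m - (m' - m) * n) = m := by ring
    have e' : (m' - m) * ((n + 1 : ℕ) : ℤ) + (m - (m' - m) * n) = m' := by push_cast; ring
    have hpn := fun k => hf.dvd_iff_of_normalized hF hp hN (n₀ := n) (by rwa [e]) k
    have hqn := fun k => hg.dvd_iff_of_normalized hG hq hN (n₀ := n) (by rwa [e]) k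
    have h1 := h0 n (by omega) (by rwa [hpn, e]) (by rwa [hqn, e])
    have h2 := h0 (n + 1) hn (by rwa [hpn, e']) (by rwa [hqn, e'])
    dsimp only at h1 h2
    rw [e] at h1
    rw [e'] at h2
    exact h1.trans h2.symm
  have hp1 : ¬(p : ℤ) ∣ 1 := (Nat.prime_iff_prime_int.mp (Fact.out : p.Prime)).not_dvd_one
  have hq1 : ¬(q : ℤ) ∣ 1 := (Nat.prime_iff_prime_int.mp (Fact.out : q.Prime)).not_dvd_one
  refine ⟨w 0 1, fun n => ?_⟩
  induction n with
  | zero =>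
    intro _ m hpm hqm
    exact (hadj 0 (by omega) m 1 hpm hqm hp1 hq1).trans
      (hadj 0 (by omega) 1 1 hp1 hq1 hp1 hq1).symm
  | succ n ih =>
    intro hn m hpm hqm
    rw [← hadj n hn 1 m hp1 hq1 hpm hqm]
    exact ih (by omega) 1 hp1 hq1

theorem prime_not_dvd_of_ne (hpq : p ≠ q) : ¬(p : ℤ) ∣ q := by
  rw [Int.natCast_dvd_natCast]
  exact fun h => hpq ((Nat.prime_dvd_prime_iff_eq Fact.out Fact.out).mp h)

theorem not_dvd_mul {x y : ℤ} (hx : ¬(p : ℤ) ∣ x) (hy : ¬(p : ℤ) ∣ y) : ¬(p : ℤ) ∣ x * y := by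
  have hp : Prime (p : ℤ) := Nat.prime_iff_prime_int.mp Fact.out
  exact fun h => (hp.dvd_or_dvd h).elim hx hy

theorem not_dvd_pow {x : ℤ} (hx : ¬(p : ℤ) ∣ x) (k : ℕ) : ¬(p : ℤ) ∣ x ^ k := by
  have hp : Prime (p : ℤ) := Nat.prime_iff_prime_int.mp Fact.out
  exact fun h => hx (hp.dvd_of_dvd_pow h)

/-- In a normalized decorated board, the decorations at heights of `p`-valuation zero and one are
related. -/
theorem IsDecoratedBoard.exists_rel (h : IsDecoratedBoard p q N H V F G w) (hp : 4 < p)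
    (hq : 4 < q) (hpq : p ≠ q) (hN : p * p ≤ N) (hF : IsNormalized p N F B)
    (hG : IsNormalized q N G C) :
    ∃ n < N, ∃ n' < N, ∃ m m' : ℤ, ¬(p : ℤ) ∣ m ∧ ¬(q : ℤ) ∣ m ∧ ¬(p : ℤ) ∣ m' ∧ ¬(q : ℤ) ∣ m' ∧
      H (w n m) (w n' (p * m')) := by
  have hpN : 4 * p < N := lt_of_lt_of_le (Nat.mul_lt_mul_of_pos_right hp (by omega)) hN
  -- On the diagonal height equals column, so column `1` has both valuations zero and column `p * y`
  -- has `p`-valuation one for `0 < y < 4`.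
  obtain ⟨a, b, hf, hg, t, t₁, t₂, h0, h1, -⟩ := h 1 0
  have hp1 : ¬(p : ℤ) ∣ 1 := (Nat.prime_iff_prime_int.mp (Fact.out : p.Prime)).not_dvd_one
  have hq1 : ¬(q : ℤ) ∣ 1 := (Nat.prime_iff_prime_int.mp (Fact.out : q.Prime)).not_dvd_one
  have hpn : ∀ n : ℕ, (p : ℤ) ∣ a * n + b ↔ (p : ℤ) ∣ n := fun n => by
    simpa using hf.dvd_iff_of_normalized hF hp (by omega) (n₀ := 1) (by simpa using hp1) n
  have hqn : ∀ n : ℕ, (q : ℤ) ∣ a * n + b ↔ (q : ℤ) ∣ n := fun n => by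
    simpa using hg.dvd_iff_of_normalized hG hq (by omega) (n₀ := 1) (by simpa using hq1) n
  have hb : (p : ℤ) ∣ b := by simpa using (hpn 0).mpr (by simp)
  obtain ⟨b', rfl⟩ := hb
  have ha : ¬(p : ℤ) ∣ a := fun hd => hf.1 ⟨hd, dvd_mul_right _ _⟩
  have ha' : (a : ZMod p) ≠ 0 := intCast_ne_zero_iff_not_dvd.mpr ha
  -- The larger of two admissible columns is used since it is positive, hence prime to `p` and `q`.
  obtain ⟨x, y, hxy, hy, -, -, hy1, -⟩ := exists_two_avoiding
    (fun x => (a : ZMod p) * (x : ℕ) + b' = 0) (fun x => (a : ZMod p) * (x : ℕ) + b' = 0)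
    (eq_of_affine_eq_zero (by omega) (.inl ha')) (eq_of_affine_eq_zero (by omega) (.inl ha'))
  have hpy : ¬(p : ℤ) ∣ y := not_dvd_of_pos_of_lt (by omega) (by omega)
  have hqy : ¬(q : ℤ) ∣ y := not_dvd_of_pos_of_lt (by omega) (by omega)
  have hc : ¬(p : ℤ) ∣ a * y + b' := by
    rw [← intCast_ne_zero_iff_not_dvd]
    push_cast
    exact hy1
  have hlt : p * y < N := by nlinarith
  have e0 := h0 1 (by omega) (by rw [hpn]; simpa using hp1) (by rw [hqn]; simpa using hq1)
  have e1 := (h1 ha).2 (p * y) hlt (a * y + b') (by push_cast; ring) hc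
    (by
      rw [hqn]
      push_cast
      exact not_dvd_mul (prime_not_dvd_of_ne hpq.symm) hqy)
  refine ⟨1, by omega, p * y, hlt, 1, y, hp1, hq1, hpy, hqy, ?_⟩
  have := (h1 ha).1
  rw [← e0, ← e1] at this
  simpa using this

/-- The points of a decorated board at heights divisible by `p ^ k q ^ l` form a normalized decorated
board, provided that those at heights divisible by `p ^ k` and by `q ^ l` are normalized. -/
theorem IsDecoratedBoard.exists_const_of_levels (h : IsDecoratedBoard p q N H V F G w) (hp : 4 < p)
    (hq : 4 < q) (hpq : p ≠ q) (hN : 4 ≤ N) {k l : ℕ}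
    (hF : IsNormalized p N (fun n m => F n ((p : ℤ) ^ k * m)) B)
    (hG : IsNormalized q N (fun n m => G n ((q : ℤ) ^ l * m)) C) :
    IsDecoratedBoard p q N H V (fun n m => F n ((p : ℤ) ^ k * (q : ℤ) ^ l * m))
      (fun n m => G n ((p : ℤ) ^ k * (q : ℤ) ^ l * m))
      (fun n m => w n ((p : ℤ) ^ k * (q : ℤ) ^ l * m)) ∧
    IsNormalized p N (fun n m => F n ((p : ℤ) ^ k * (q : ℤ) ^ l * m))
      (B * (((q : ℤ) ^ l : ℤ) : ZMod p)) ∧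
    IsNormalized q N (fun n m => G n ((p : ℤ) ^ k * (q : ℤ) ^ l * m))
      (C * (((p : ℤ) ^ k : ℤ) : ZMod q)) ∧
    ∃ v, ∀ n < N, ∀ m : ℤ, ¬(p : ℤ) ∣ m → ¬(q : ℤ) ∣ m →
      w n ((p : ℤ) ^ k * (q : ℤ) ^ l * m) = v := by
  have h' := h.comp_affine 0 0 ((p : ℤ) ^ k * (q : ℤ) ^ l)
  simp only [zero_mul, zero_add] at h'
  have hF' := hF.comp_mul (not_dvd_pow (prime_not_dvd_of_ne hpq) l)
  have hG' := hG.comp_mul (not_dvd_pow (prime_not_dvd_of_ne hpq.symm) k)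
  simp only [← mul_assoc] at hF' hG'
  rw [mul_comm ((q : ℤ) ^ l)] at hG'
  exact ⟨h', hF', hG', h'.exists_const hp hq hN hF' hG'⟩

end DecoratedBoard

theorem exists_int_congr {x y : ℤ} (h : IsCoprime x y) (c d : ℤ) :
    ∃ z : ℤ, x ∣ z - c ∧ y ∣ z - d := by
  obtain ⟨r, s, hrs⟩ := h
  exact ⟨d * (r * x) + c * (s * y), ⟨(d - c) * r, by linear_combination c * hrs⟩,
    ⟨(c - d) * s, by linear_combination d * hrs⟩⟩

theorem isCoprime_prime_pow {p q : ℕ} [Fact p.Prime] [Fact q.Prime] (hpq : p ≠ q) (k l : ℕ) :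
    IsCoprime ((p : ℤ) ^ k) ((q : ℤ) ^ l) :=
  (Nat.isCoprime_iff_coprime.mpr ((Nat.coprime_primes Fact.out Fact.out).mpr hpq)).pow

/-- The decoration of a decorated board with non-constant columns gives a solution of the domino
problem on arbitrarily large squares. -/
theorem IsDecoratedBoard.exists_square {W : Type*} {p q N : ℕ} [Fact p.Prime] [Fact q.Prime]
    {H V : W → W → Prop} {F : ℕ → ℤ → ZMod p} {G : ℕ → ℤ → ZMod q} {w : ℕ → ℤ → W}
    (h : IsDecoratedBoard p q N H V F G w) (hp : 48 < p) (hq : 48 < q) (hpq : p ≠ q)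
    (hpN : p * p ≤ N) (hqN : q * q ≤ N) (hF0 : ∀ n m, F n m ≠ 0) (hG0 : ∀ n m, G n m ≠ 0)
    (hF : ∀ n < N, ∃ m m' : ℤ, F n m ≠ F n m') (hG : ∀ n < N, ∃ m m' : ℤ, G n m ≠ G n m')
    (K : ℕ) : ∃ T : ℕ → ℕ → W, ∀ k < K, ∀ l < K,
      H (T k l) (T (k + 1) l) ∧ V (T k l) (T k (l + 1)) := by
  obtain ⟨X₁, Y₁, B, hB⟩ := (h.isDigitBoard hF0).exists_levels hp hpN hF K
  obtain ⟨X₂, Y₂, C, hC⟩ := (h.symm.isDigitBoard hG0).exists_levels hq hqN hG K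
  -- Levels up to `K` see the shear only modulo `p ^ (K + 1)` and `q ^ (K + 1)`, so one shear serves
  -- both primes.
  obtain ⟨X, hX₁, hX₂⟩ := exists_int_congr (isCoprime_prime_pow hpq (K + 1) (K + 1)) X₁ X₂
  obtain ⟨Y, hY₁, hY₂⟩ := exists_int_congr (isCoprime_prime_pow hpq (K + 1) (K + 1)) Y₁ Y₂
  have hN : 4 ≤ N := by nlinarith
  have h' := h.comp_affine X Y 1
  simp only [one_mul] at h'
  have key := fun (k l : ℕ) (hk : k ≤ K) (hl : l ≤ K) =>
    h'.exists_const_of_levels (k := k) (l := l) (by omega) (by omega) hpq hN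
      ((hB k hk).congr_affine (Nat.lt_succ_of_le hk) hX₁ hY₁)
      ((hC l hl).congr_affine (Nat.lt_succ_of_le hl) hX₂ hY₂)
  have hT : ∀ k l : ℕ, ∃ v : W, k ≤ K → l ≤ K → ∀ n < N, ∀ m : ℤ, ¬(p : ℤ) ∣ m → ¬(q : ℤ) ∣ m →
      w n (X * n + Y + (p : ℤ) ^ k * (q : ℤ) ^ l * m) = v := by
    intro k l
    by_cases hkl : k ≤ K ∧ l ≤ K
    · obtain ⟨-, -, -, v, hv⟩ := key k l hkl.1 hkl.2
      exact ⟨v, fun _ _ => hv⟩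
    · exact ⟨w 0 0, fun hk hl => absurd ⟨hk, hl⟩ hkl⟩
  choose T hT using hT
  refine ⟨T, fun k hk l hl => ?_⟩
  obtain ⟨hs, hs₁, hs₂, -⟩ := key k l hk.le hl.le
  constructor
  · obtain ⟨n, hn, n', hn', m, m', hpm, hqm, hpm', hqm', hH⟩ :=
      hs.exists_rel (by omega) (by omega) hpq hpN hs₁ hs₂
    rw [← hT k l hk.le hl.le n hn m hpm hqm, ← hT (k + 1) l hk hl.le n' hn' m' hpm' hqm']
    convert hH using 3
    ring
  · obtain ⟨n, hn, n', hn', m, m', hqm, hpm, hqm', hpm', hV⟩ :=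
      hs.symm.exists_rel (by omega) (by omega) hpq.symm hqN hs₂ hs₁
    rw [← hT k l hk.le hl.le n hn m hpm hqm, ← hT k (l + 1) hk.le hl n' hn' m' hpm' hqm']
    convert hV using 3
    ring

/-! ### Compactness and the quadrant -/

/-- Compactness: solvability on arbitrarily large squares gives solvability on the quadrant. -/
theorem exists_quadrant_of_squares {W : Type*} [Finite W] {H V : W → W → Prop}
    (h : ∀ K : ℕ, ∃ T : ℕ → ℕ → W, ∀ k < K, ∀ l < K,
      H (T k l) (T (k + 1) l) ∧ V (T k l) (T k (l + 1))) :
    ∃ T : ℕ → ℕ → W, ∀ k l, H (T k l) (T (k + 1) l) ∧ V (T k l) (T k (l + 1)) := by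
  choose T hT using h
  -- Along a non-principal ultrafilter each cell has a limit pip, because `W` is finite.
  have hlim : ∀ k l, ∃ v, ∀ᶠ K in (Filter.hyperfilter ℕ : Filter ℕ), T K k l = v := by
    intro k l
    exact Ultrafilter.eventually_exists_iff.mp (Filter.Eventually.of_forall fun K => ⟨_, rfl⟩)
  choose S hS using hlim
  refine ⟨S, fun k l => ?_⟩
  have hlarge : ∀ᶠ K in (Filter.hyperfilter ℕ : Filter ℕ), k < K ∧ l < K := by
    have : ∀ᶠ K in Filter.atTop, k < K ∧ l < K :=
      (Filter.eventually_gt_atTop k).and (Filter.eventually_gt_atTop l)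
    exact this.filter_mono Nat.hyperfilter_le_atTop
  obtain ⟨K, ⟨hk, hl⟩, h0, h1, h2⟩ :=
    (hlarge.and ((hS k l).and ((hS (k + 1) l).and (hS k (l + 1))))).exists
  rw [← h0, ← h1, ← h2]
  exact hT K k hk l hl

theorem DominoSet.solvableOn_natQuadrant_iff (R : DominoSet.{u}) :
    R.SolvableOn natQuadrant ↔ ∃ T : ℕ → ℕ → R.Pip, ∀ k l,
      (T k l, T (k + 1) l) ∈ R.horiz ∧ (T k l, T k (l + 1)) ∈ R.vert := by
  constructor
  · rintro ⟨T, hH, hV⟩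
    refine ⟨fun k l => T ⟨(k, l), by simp [natQuadrant]⟩, fun k l => ⟨hH _ _ ?_, hV _ _ ?_⟩⟩ <;>
      simp
  · rintro ⟨T, hT⟩
    refine ⟨fun s => T s.1.1.toNat s.1.2.toNat, ?_, ?_⟩
    · rintro ⟨⟨x, y⟩, hx, hy⟩ ⟨t, ht⟩ rfl
      dsimp only at hx hy
      have := (hT x.toNat y.toNat).1
      simpa [Int.toNat_add hx] using this
    · rintro ⟨⟨x, y⟩, hx, hy⟩ ⟨t, ht⟩ rfl
      dsimp only at hx hy
      have := (hT x.toNat y.toNat).2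
      simpa [Int.toNat_add hy] using this

/-! ### From Sudoku solutions to the domino problem -/

theorem padicNu_eq_zero {p : ℕ} {x : ℤ} (h : ¬(p : ℤ) ∣ x) : padicNu p x = 0 :=
  emultiplicity_eq_zero.mpr h

theorem not_dvd_of_nondegenerateMod {p : ℕ} {a b : ℤ} (h : NondegenerateMod p a b) :
    ¬((p : ℤ) ∣ a ∧ (p : ℤ) ∣ b) := by
  rwa [NondegenerateMod, ZMod.intCast_zmod_eq_zero_iff_dvd, ZMod.intCast_zmod_eq_zero_iff_dvd] at h

theorem rectSide_eq_one {p : ℕ} {a : ℤ} (h : ¬(p : ℤ) ∣ a) : rectSide p a = 1 :=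
  if_pos (padicNu_eq_zero h)

section LastDigit

variable {p : ℕ} [Fact p.Prime]

theorem pow_mul_not_pow_succ_dvd {k : ℕ} {c : ℤ} (hc : ¬(p : ℤ) ∣ c) :
    ¬(p : ℤ) ^ (k + 1) ∣ (p : ℤ) ^ k * c := by
  have hp : (p : ℤ) ≠ 0 := by exact_mod_cast (Fact.out : p.Prime).ne_zero
  rwa [pow_succ, mul_dvd_mul_iff_left (pow_ne_zero k hp)]

theorem padicNu_pow_mul {k : ℕ} {c : ℤ} (hc : ¬(p : ℤ) ∣ c) :
    padicNu p ((p : ℤ) ^ k * c) = k :=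
  emultiplicity_eq_coe.mpr ⟨dvd_mul_right _ _, pow_mul_not_pow_succ_dvd hc⟩

theorem multiplicity_pow_mul {k : ℕ} {c : ℤ} (hc : ¬(p : ℤ) ∣ c) :
    multiplicity (p : ℤ) ((p : ℤ) ^ k * c) = k :=
  multiplicity_eq_of_emultiplicity_eq_some (padicNu_pow_mul hc)

theorem lastDigit_pow_mul {k : ℕ} {c : ℤ} (hc : ¬(p : ℤ) ∣ c) :
    (lastDigit p ((p : ℤ) ^ k * c) : ZMod p) = c := by
  have hp : (p : ℤ) ≠ 0 := by exact_mod_cast (Fact.out : p.Prime).ne_zero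
  have h0 : (p : ℤ) ^ k * c ≠ 0 := mul_ne_zero (pow_ne_zero k hp) (by rintro rfl; simp at hc)
  rw [lastDigit, dif_neg h0, Units.val_mk0, multiplicity_pow_mul hc,
    Int.mul_ediv_cancel_left _ (pow_ne_zero k hp)]

theorem exists_eq_pow_mul {x : ℤ} (hx : x ≠ 0) : ∃ (k : ℕ) (c : ℤ), x = (p : ℤ) ^ k * c ∧
    ¬(p : ℤ) ∣ c := by
  have hf : FiniteMultiplicity (p : ℤ) x :=
    Int.finiteMultiplicity_iff.mpr ⟨by simpa using (Fact.out : p.Prime).ne_one, hx⟩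
  obtain ⟨c, hc⟩ := hf.exists_eq_pow_mul_and_not_dvd
  exact ⟨_, c, hc⟩

theorem isDigitLine_of_lastDigit {N : ℕ} {f : ℕ → ZMod p} {a b : ℤ} (h : NondegenerateMod p a b)
    (hf : ∀ n < N, padicNu p (a * n + b) ≤ (rectSide p a : ℕ∞) →
      f n = lastDigit p (a * n + b)) : IsDigitLine p N f a b := by
  refine ⟨not_dvd_of_nondegenerateMod h, fun n hn hd => ?_, fun ha n hn c hc hd => ?_⟩
  · rw [hf n hn (by simp [padicNu_eq_zero hd])]
    simpa using lastDigit_pow_mul (k := 0) hd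
  · have hc' : a * n + b = (p : ℤ) ^ 1 * c := by rw [hc, pow_one]
    rw [hf n hn (by rw [hc', padicNu_pow_mul hd, rectSide_eq_one ha]), hc', lastDigit_pow_mul hd]

end LastDigit

theorem isDecoratedLine_of_mem_decoratedRule {p₁ p₂ : ℕ} [Fact p₁.Prime] [Fact p₂.Prime]
    {R : DominoSet.{u}} {f : ℕ → (ZMod p₁)ˣ} {g : ℕ → (ZMod p₂)ˣ} {w : ℕ → R.Pip}
    (h : (fun n : Fin (p₁ ^ 2 * p₂ ^ 2) => (f n, g n, w n)) ∈ decoratedRule p₁ p₂ R) :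
    IsDecoratedLine p₁ p₂ (p₁ ^ 2 * p₂ ^ 2) (fun x y => (x, y) ∈ R.horiz)
      (fun x y => (x, y) ∈ R.vert) (fun n => (f n : ZMod p₁)) (fun n => (g n : ZMod p₂)) w := by
  obtain ⟨a, b, hd₁, hd₂, T, ⟨hH, hV⟩, hT⟩ := h
  have hmem : ∀ x y : ℕ, x ≤ rectSide p₁ a → y ≤ rectSide p₂ a → ((x : ℤ), (y : ℤ)) ∈
      dominoRect (0, 0) ((rectSide p₁ a : ℤ), (rectSide p₂ a : ℤ)) := by
    intro x y hx hy
    simp only [dominoRect, Set.mem_ofPred_eq]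
    omega
  have hw : ∀ (x y : ℕ) (hx : x ≤ rectSide p₁ a) (hy : y ≤ rectSide p₂ a),
      ∀ n < p₁ ^ 2 * p₂ ^ 2, padicNu p₁ (a * n + b) = x → padicNu p₂ (a * n + b) = y →
      w n = T ⟨((x : ℤ), (y : ℤ)), hmem x y hx hy⟩ := fun x y hx hy n hn h₁ h₂ =>
    (hT ⟨n, hn⟩).2.2 x y (hmem x y hx hy) h₁ h₂
  refine ⟨a, b, isDigitLine_of_lastDigit hd₁ fun n hn hv => by
      rw [← (hT ⟨n, hn⟩).1 hv], isDigitLine_of_lastDigit hd₂ fun n hn hv => by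
      rw [← (hT ⟨n, hn⟩).2.1 hv], ?_⟩
  have hv₁ : ∀ {x c : ℤ}, x = p₁ * c → ¬(p₁ : ℤ) ∣ c → padicNu p₁ x = (1 : ℕ) := fun hx hc => by
    rw [hx, ← padicNu_pow_mul hc, pow_one]
  have hv₂ : ∀ {x c : ℤ}, x = p₂ * c → ¬(p₂ : ℤ) ∣ c → padicNu p₂ x = (1 : ℕ) := fun hx hc => by
    rw [hx, ← padicNu_pow_mul hc, pow_one]
  classical
  -- The cells `(1, 0)` and `(0, 1)` lie in the rectangle only if the respective prime does not
  -- divide `a`; otherwise `w 0` is an arbitrary filler.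
  refine ⟨T ⟨((0 : ℕ), (0 : ℕ)), hmem 0 0 (by simp) (by simp)⟩,
    if ha : (p₁ : ℤ) ∣ a then w 0 else
      T ⟨((1 : ℕ), (0 : ℕ)), hmem 1 0 (by rw [rectSide_eq_one ha]) (by simp)⟩,
    if ha : (p₂ : ℤ) ∣ a then w 0 else
      T ⟨((0 : ℕ), (1 : ℕ)), hmem 0 1 (by simp) (by rw [rectSide_eq_one ha])⟩, ?_, ?_, ?_⟩
  · intro n hn h₁ h₂
    exact hw 0 0 (by simp) (by simp) n hn (padicNu_eq_zero h₁) (padicNu_eq_zero h₂)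
  · intro ha
    rw [dif_neg ha]
    exact ⟨hH _ _ (by simp), fun n hn c hc hpc hq =>
      hw 1 0 (by rw [rectSide_eq_one ha]) (by simp) n hn (hv₁ hc hpc) (padicNu_eq_zero hq)⟩
  · intro ha
    rw [dif_neg ha]
    exact ⟨hV _ _ (by simp), fun n hn c hc hqc hp =>
      hw 0 1 (by simp) (by rw [rectSide_eq_one ha]) n hn (padicNu_eq_zero hp) (hv₂ hc hqc)⟩

theorem solvableOn_natQuadrant_of_sudoku {p₁ p₂ : ℕ} [Fact p₁.Prime] [Fact p₂.Prime]
    (hne : p₁ ≠ p₂) (h₁ : 48 < p₁) (h₂ : 48 < p₂) {R : DominoSet.{u}}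
    {F₁ : SudokuBoard (p₁ ^ 2 * p₂ ^ 2) → (ZMod p₁)ˣ}
    {F₂ : SudokuBoard (p₁ ^ 2 * p₂ ^ 2) → (ZMod p₂)ˣ}
    {w : SudokuBoard (p₁ ^ 2 * p₂ ^ 2) → R.Pip}
    (hF : IsSudokuSolution (decoratedRule p₁ p₂ R) (fun c => (F₁ c, F₂ c, w c)))
    (hc₁ : HasNonconstantColumns F₁) (hc₂ : HasNonconstantColumns F₂) :
    R.SolvableOn natQuadrant := by
  have := R.finite_pip
  obtain ⟨v₀⟩ := R.nonempty_pip
  let f₁ : ℕ → ℤ → (ZMod p₁)ˣ := fun n m => if h : n < p₁ ^ 2 * p₂ ^ 2 then F₁ (⟨n, h⟩, m) else 1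
  let f₂ : ℕ → ℤ → (ZMod p₂)ˣ := fun n m => if h : n < p₁ ^ 2 * p₂ ^ 2 then F₂ (⟨n, h⟩, m) else 1
  let v : ℕ → ℤ → R.Pip := fun n m => if h : n < p₁ ^ 2 * p₂ ^ 2 then w (⟨n, h⟩, m) else v₀
  have hboard : IsDecoratedBoard p₁ p₂ (p₁ ^ 2 * p₂ ^ 2) (fun x y => (x, y) ∈ R.horiz)
      (fun x y => (x, y) ∈ R.vert) (fun n m => (f₁ n m : ZMod p₁))
      (fun n m => (f₂ n m : ZMod p₂)) v := by
    intro j i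
    refine isDecoratedLine_of_mem_decoratedRule (f := fun n => f₁ n (j * n + i))
      (g := fun n => f₂ n (j * n + i)) (w := fun n => v n (j * n + i)) ?_
    convert hF j i using 2 with n
    simp [f₁, f₂, v]
  rw [R.solvableOn_natQuadrant_iff]
  refine exists_quadrant_of_squares (H := fun x y => (x, y) ∈ R.horiz)
    (V := fun x y => (x, y) ∈ R.vert) fun K => hboard.exists_square h₁ h₂ hne ?_ ?_
    (fun _ _ => Units.ne_zero _) (fun _ _ => Units.ne_zero _) ?_ ?_ K
  · rw [← sq]
    exact Nat.le_mul_of_pos_right _ (by positivity)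
  · rw [← sq]
    exact Nat.le_mul_of_pos_left _ (by positivity)
  · intro n hn
    obtain ⟨m, m', h⟩ := hc₁ ⟨n, hn⟩
    exact ⟨m, m', by simpa [f₁, hn, Units.ext_iff] using h⟩
  · intro n hn
    obtain ⟨m, m', h⟩ := hc₂ ⟨n, hn⟩
    exact ⟨m, m', by simpa [f₂, hn, Units.ext_iff] using h⟩

/-! ### From a tiling of the quadrant to a Sudoku solution -/

/-- Replacing a factor `p ^ k c`, with `c` prime to `p`, by a factor `v ≡ c` modulo `p` does not
change the last non-zero digit. -/
theorem lastDigit_mul_eq {p : ℕ} [Fact p.Prime] {k : ℕ} {c v y : ℤ} (hc : ¬(p : ℤ) ∣ c)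
    (hv : (p : ℤ) ∣ v - c) (hy : y ≠ 0) :
    lastDigit p ((p : ℤ) ^ k * c * y) = lastDigit p (v * y) := by
  obtain ⟨s, d, rfl, hd⟩ := exists_eq_pow_mul (p := p) hy
  have hv' : ¬(p : ℤ) ∣ v := fun h => hc ((dvd_sub_right h).mp hv)
  rw [Units.ext_iff, show (p : ℤ) ^ k * c * ((p : ℤ) ^ s * d) = (p : ℤ) ^ (k + s) * (c * d) by ring,
    show v * ((p : ℤ) ^ s * d) = (p : ℤ) ^ s * (v * d) by ring,
    lastDigit_pow_mul (not_dvd_mul hc hd), lastDigit_pow_mul (not_dvd_mul hv' hd)]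
  push_cast
  congr 1
  rw [← ZMod.intCast_zmod_eq_zero_iff_dvd] at hv
  push_cast at hv
  exact (sub_eq_zero.mp hv).symm

/-- Since `v` is prime to `p`, trading `p ^ k * c` for `v` lowers the valuation by exactly `k`; the
tiling is then to be read from an origin shifted by `k`. -/
theorem multiplicity_mul_eq {p : ℕ} [Fact p.Prime] {k s : ℕ} {c v y : ℤ} (hc : ¬(p : ℤ) ∣ c)
    (hv : (p : ℤ) ∣ v - c) (hy : y ≠ 0) (hs : padicNu p (v * y) = s) :
    multiplicity (p : ℤ) ((p : ℤ) ^ k * c * y) = k + s := by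
  obtain ⟨r, d, rfl, hd⟩ := exists_eq_pow_mul (p := p) hy
  have hv' : ¬(p : ℤ) ∣ v := fun h => hc ((dvd_sub_right h).mp hv)
  rw [show v * ((p : ℤ) ^ r * d) = (p : ℤ) ^ r * (v * d) by ring,
    padicNu_pow_mul (not_dvd_mul hv' hd), Nat.cast_inj] at hs
  subst hs
  rw [show (p : ℤ) ^ k * c * ((p : ℤ) ^ r * d) = (p : ℤ) ^ (k + r) * (c * d) by ring,
    multiplicity_pow_mul (not_dvd_mul hc hd)]

theorem padicNu_zero (p : ℕ) : padicNu p 0 = ⊤ := emultiplicity_zero _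

theorem nondegenerateMod_of_isCoprime {p : ℕ} [Fact p.Prime] {v a b : ℤ} (hv : ¬(p : ℤ) ∣ v)
    (hab : IsCoprime a b) : NondegenerateMod p (v * a) (v * b) := by
  rw [NondegenerateMod, ZMod.intCast_zmod_eq_zero_iff_dvd, ZMod.intCast_zmod_eq_zero_iff_dvd]
  rintro ⟨ha, hb⟩
  obtain ⟨r, s, hrs⟩ := hab
  apply hv
  have : v = r * (v * a) + s * (v * b) := by linear_combination -v * hrs
  rw [this]
  exact dvd_add (ha.mul_left r) (hb.mul_left s)

theorem lastDigit_two_ne_lastDigit_one {p : ℕ} [Fact p.Prime] (hp : 2 < p) :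
    lastDigit p 2 ≠ lastDigit p 1 := by
  intro h
  have h2 := lastDigit_pow_mul (p := p) (k := 0)
    (not_dvd_of_pos_of_lt (c := 2) (by norm_num) hp)
  have h1 := lastDigit_pow_mul (p := p) (k := 0)
    (not_dvd_of_pos_of_lt (c := 1) (by norm_num) (by omega))
  simp only [pow_zero, one_mul, Nat.cast_ofNat, Nat.cast_one] at h1 h2
  rw [h, h1] at h2
  push_cast at h2
  exact one_ne_zero (α := ZMod p) (by linear_combination -h2)

/-- The form `j n + i` may be degenerate. Its content `g` is `p₁ ^ k * c` and also `p₂ ^ l * d`;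
replacing it by one `v ≡ c` modulo `p₁`, `v ≡ d` modulo `p₂` makes the form non-degenerate at both
primes, keeps the last digits and shifts the valuations by `(k, l)`. -/
theorem mem_decoratedRule_of_quadrant {p₁ p₂ : ℕ} [Fact p₁.Prime] [Fact p₂.Prime]
    (hne : p₁ ≠ p₂) {R : DominoSet.{u}} {T : ℕ → ℕ → R.Pip}
    (hT : ∀ k l, (T k l, T (k + 1) l) ∈ R.horiz ∧ (T k l, T k (l + 1)) ∈ R.vert) (j i : ℤ) :
    (fun n : Fin (p₁ ^ 2 * p₂ ^ 2) =>
      (lastDigit p₁ (j * ((n : ℕ) : ℤ) + i), lastDigit p₂ (j * ((n : ℕ) : ℤ) + i),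
        T (multiplicity (p₁ : ℤ) (j * ((n : ℕ) : ℤ) + i))
          (multiplicity (p₂ : ℤ) (j * ((n : ℕ) : ℤ) + i)))) ∈ decoratedRule p₁ p₂ R := by
  have hp₁ : ¬(p₁ : ℤ) ∣ 1 := (Nat.prime_iff_prime_int.mp (Fact.out : p₁.Prime)).not_dvd_one
  have hp₂ : ¬(p₂ : ℤ) ∣ 1 := (Nat.prime_iff_prime_int.mp (Fact.out : p₂.Prime)).not_dvd_one
  by_cases h0 : j = 0 ∧ i = 0
  · obtain ⟨rfl, rfl⟩ := h0
    -- On the zero line all digits are `1` by convention, as for the constant form `1`. Its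
    -- rectangle is a single cell, so any pip is allowed there.
    refine ⟨0, 1, ?_, ?_, fun _ => T (multiplicity (p₁ : ℤ) 0) (multiplicity (p₂ : ℤ) 0),
      ⟨?_, ?_⟩, ?_⟩
    · simpa using nondegenerateMod_of_isCoprime (v := 1) hp₁ (isCoprime_zero_left.mpr isUnit_one)
    · simpa using nondegenerateMod_of_isCoprime (v := 1) hp₂ (isCoprime_zero_left.mpr isUnit_one)
    · rintro ⟨s, hs⟩ ⟨t, ht⟩ rfl
      simp [dominoRect, rectSide, padicNu_zero] at hs ht
      omega
    · rintro ⟨s, hs⟩ ⟨t, ht⟩ rfl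
      simp [dominoRect, rectSide, padicNu_zero] at hs ht
      omega
    · have h1 : ∀ (p : ℕ) [Fact p.Prime], lastDigit p 0 = lastDigit p 1 := by
        intro p _
        have hp : ¬(p : ℤ) ∣ 1 := (Nat.prime_iff_prime_int.mp (Fact.out : p.Prime)).not_dvd_one
        have := lastDigit_pow_mul (k := 0) hp
        rw [pow_zero, one_mul] at this
        rw [Units.ext_iff, this]
        simp [lastDigit]
      intro n
      simp [h1]
  · obtain ⟨g, a, b, hg, hab, rfl, rfl⟩ : ∃ g a b : ℤ, g ≠ 0 ∧ IsCoprime a b ∧ j = g * a ∧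
        i = g * b := by
      have hg : Int.gcd j i ≠ 0 := by rwa [Ne, Int.gcd_eq_zero_iff]
      refine ⟨Int.gcd j i, j / Int.gcd j i, i / Int.gcd j i, by exact_mod_cast hg, ?_, ?_, ?_⟩
      · exact Int.isCoprime_iff_gcd_eq_one.mpr
          (Int.gcd_ediv_gcd_ediv_gcd (Nat.pos_of_ne_zero hg))
      · exact (Int.mul_ediv_cancel' (Int.gcd_dvd_left ..)).symm
      · exact (Int.mul_ediv_cancel' (Int.gcd_dvd_right ..)).symm
    obtain ⟨k, c, hkc, hc⟩ := exists_eq_pow_mul (p := p₁) hg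
    obtain ⟨l, d, hld, hd⟩ := exists_eq_pow_mul (p := p₂) hg
    obtain ⟨v, hvc, hvd⟩ := exists_int_congr (isCoprime_prime_pow hne 1 1) c d
    rw [pow_one] at hvc hvd
    have hv₁ : ¬(p₁ : ℤ) ∣ v := fun h => hc ((dvd_sub_right h).mp hvc)
    have hv₂ : ¬(p₂ : ℤ) ∣ v := fun h => hd ((dvd_sub_right h).mp hvd)
    refine ⟨v * a, v * b, nondegenerateMod_of_isCoprime hv₁ hab,
      nondegenerateMod_of_isCoprime hv₂ hab,
      fun s => T (k + s.1.1.toNat) (l + s.1.2.toNat), ⟨?_, ?_⟩, fun n => ?_⟩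
    · rintro ⟨⟨x, y⟩, ⟨hx, -⟩, -⟩ ⟨t, ht⟩ rfl
      dsimp only at hx
      simpa [Int.toNat_add hx, ← add_assoc] using (hT (k + x.toNat) (l + y.toNat)).1
    · rintro ⟨⟨x, y⟩, -, ⟨hy, -⟩⟩ ⟨t, ht⟩ rfl
      dsimp only at hy
      simpa [Int.toNat_add hy, ← add_assoc] using (hT (k + x.toNat) (l + y.toNat)).2
    · have ev : v * a * ((n : ℕ) : ℤ) + v * b = v * (a * (n : ℕ) + b) := by ring
      have eg : g * a * ((n : ℕ) : ℤ) + g * b = g * (a * (n : ℕ) + b) := by ring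
      simp only [ev, eg]
      -- A zero of the form has infinite valuation and is subject to no condition.
      have hy : ∀ (p t : ℕ), padicNu p (v * (a * (n : ℕ) + b)) ≤ t → a * ((n : ℕ) : ℤ) + b ≠ 0 := by
        intro p t ht h
        rw [h, mul_zero, padicNu_zero] at ht
        simp at ht
      refine ⟨fun h => ?_, fun h => ?_, fun s t hs h₁ h₂ => ?_⟩
      · rw [← lastDigit_mul_eq (k := k) hc hvc (hy _ _ h), hkc]
      · rw [← lastDigit_mul_eq (k := l) hd hvd (hy _ _ h), hld]
      · have hy0 := hy _ _ h₁.le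
        have m₁ := multiplicity_mul_eq (k := k) hc hvc hy0 h₁
        have m₂ := multiplicity_mul_eq (k := l) hd hvd hy0 h₂
        rw [← hkc] at m₁
        rw [← hld] at m₂
        simp [m₁, m₂]

theorem mainTheorem6 (p₁ p₂ : ℕ) [Fact p₁.Prime] [Fact p₂.Prime] (hne : p₁ ≠ p₂)
    (h₁ : 48 < p₁) (h₂ : 48 < p₂) (R : DominoSet.{u}) :
    R.SolvableOn natQuadrant ↔
      ∃ (F₁ : SudokuBoard (p₁ ^ 2 * p₂ ^ 2) → (ZMod p₁)ˣ)
        (F₂ : SudokuBoard (p₁ ^ 2 * p₂ ^ 2) → (ZMod p₂)ˣ)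
        (w : SudokuBoard (p₁ ^ 2 * p₂ ^ 2) → R.Pip),
        IsSudokuSolution (decoratedRule p₁ p₂ R) (fun c => (F₁ c, F₂ c, w c)) ∧
          HasNonconstantColumns F₁ ∧ HasNonconstantColumns F₂ := by
  constructor
  · rw [R.solvableOn_natQuadrant_iff]
    rintro ⟨T, hT⟩
    exact ⟨fun c => lastDigit p₁ c.2, fun c => lastDigit p₂ c.2,
      fun c => T (multiplicity (p₁ : ℤ) c.2) (multiplicity (p₂ : ℤ) c.2),
      mem_decoratedRule_of_quadrant hne hT,
      fun _ => ⟨2, 1, lastDigit_two_ne_lastDigit_one (by omega)⟩,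
      fun _ => ⟨2, 1, lastDigit_two_ne_lastDigit_one (by omega)⟩⟩
  · rintro ⟨F₁, F₂, w, hF, hc₁, hc₂⟩
    exact solvableOn_natQuadrant_of_sudoku hne h₁ h₂ hF hc₁ hc₂
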